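/- Let $\mathfrak{M}$ be a von Neumann algebra with a normal faithful tracial state $\tau$, and let $\mathfrak{M}_{\mathrm{sa}}$ be its set of self-adjoint elements. For $X\in\mathfrak{M}_{\mathrm{sa}}$ the eigenvalue function of $X$ is $\lambda_X(s)=\inf\{t\in\mathbb{R} : \tau(1_{(t,\infty)}(X))\le s\}$, $s\in[0,1)$, where $1_{(t,\infty)}(X)$ is the spectral projection of $X$ for $(t,\infty)$. For bounded measurable $f,g$ on $[0,1)$ write $g\prec f$ if $\int_0^t g\,dx\le\int_0^t f\,dx$ for all $t\in[0,1]$, with equality for $t=1$. For $C\in\mathfrak{M}_{\mathrm{sa}}$ and $T\in\mathfrak{M}$ the $C$-numerical range of $T$ is $$V_C(T)=\{\tau(TX) : X\in\mathfrak{M}_{\mathrm{sa}},\ \lambda_X\prec\lambda_C\}\subseteq\mathbb{C}.$$ Let $T,S\in\mathfrak{M}$ and $C,C_1,C_2\in\mathfrak{M}_{\mathrm{sa}}$, and let $\Re(T)=\frac{1}{2}(T+T^*)$ and $\Im(T)=\frac{1}{2i}(T-T^*)$. Then: 1. $V_C(T)$ is convex. 2. $V_C(T^*)=\{\overline{z}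 : z\in V_C(T)\}$. 3. $V_C(\Re(T))=\{\Re(z) : z\in V_C(T)\}$ and $V_C(\Im(T))=\{\Im(z) : z\in V_C(T)\}$. 4. $V_C(T+S)\subseteq V_C(T)+V_C(S)=\{z+w : z\in V_C(T),\,w\in V_C(S)\}$. 5. $V_C(zI+wT)=z\tau(C)+wV_C(T)$ for all $z,w\in\mathbb{C}$. 6. $V_C(U^*TU)=V_C(T)$ for all unitaries $U\in\mathfrak{M}$. 7. If $\lambda_{C_1}\prec\lambda_{C_2}$, then $V_{C_1}(T)\subseteq V_{C_2}(T)$. 8. $V_{aC+bI}(T)=aV_C(T)+b\tau(T)$ for all $a,b\in\mathbb{R}$. -/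

import Mathlib

open scoped ComplexOrder ComplexStarModule Pointwise

namespace CNumericalRange

noncomputable section

variable {H : Type*} [NormedAddCommGroup H] [InnerProductSpace ℂ H] [CompleteSpace H]

/-- The spectral projection `1_{(t,∞)}(T)` of a self-adjoint operator `T`: the orthogonal
projection onto the closure of the range of `(T - t)₊`, which is `x ↦ max (x - t) 0` applied to `T`
in the continuous functional calculus. -/
def spectralProjIoi (T : H →L[ℂ] H) (t : ℝ) : H →L[ℂ] H :=
  (cfc (fun x : ℝ => max (x - t) 0) T).range.topologicalClosure.starProjection

/-- The spectral projections of an element of a von Neumann algebra belong to the algebra. -/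
theorem spectralProjIoi_mem (M : VonNeumannAlgebra H) {T : H →L[ℂ] H} (hT : T ∈ M) (t : ℝ) :
    spectralProjIoi T t ∈ M := by
  refine (VonNeumannAlgebra.IsStarProjection.mem_iff (e := spectralProjIoi T t)
    isStarProjection_starProjection M).2 ?_
  intro y hy
  have hcomm : Commute (cfc (fun x : ℝ => max (x - t) 0) T) y :=
    Commute.cfc_real (VonNeumannAlgebra.mem_commutant_iff.1 hy T hT) _
  rw [Module.End.mem_invtSubmodule]
  intro v hv
  rw [spectralProjIoi, Submodule.range_starProjection] at hv ⊢
  rw [Submodule.mem_comap]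
  refine map_mem_closure (f := y) y.continuous hv ?_
  rintro _ ⟨w, rfl⟩
  refine ⟨y w, ?_⟩
  exact congrArg (fun A : H →L[ℂ] H => A w) hcomm.eq

/-- A normal faithful tracial state on the von Neumann algebra `M`. The pair of `M` and such a
state is a tracial von Neumann algebra. -/
structure TracialState (M : VonNeumannAlgebra H) extends M.toStarSubalgebra →ₗ[ℂ] ℂ where
  map_one' : toFun 1 = 1
  nonneg' : ∀ x, 0 ≤ x → 0 ≤ toFun x
  tracial' : ∀ x y, toFun (x * y) = toFun (y * x)
  faithful' : ∀ x, toFun (star x * x) = 0 → x = 0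
  normal' : ∀ (D : Set M.toStarSubalgebra) (x : M.toStarSubalgebra), D.Nonempty →
    DirectedOn (· ≤ ·) D → (∀ d ∈ D, 0 ≤ d) → IsLUB D x →
    IsLUB ((fun d => (toFun d).re) '' D) (toFun x).re

variable {M : VonNeumannAlgebra H}

instance : CoeFun (TracialState M) fun _ => M.toStarSubalgebra → ℂ :=
  ⟨fun τ => τ.toLinearMap⟩

/-- The eigenvalue function `λ_T(s) = inf {t ∈ ℝ | τ(1_{(t,∞)}(T)) ≤ s}` of a self-adjoint `T`;
it is meaningful for `s ∈ [0,1)`. -/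
def eigenvalueFun (τ : TracialState M) (T : M.toStarSubalgebra) (s : ℝ) : ℝ :=
  sInf {t : ℝ | (τ ⟨spectralProjIoi (T : H →L[ℂ] H) t, spectralProjIoi_mem M T.2 t⟩).re ≤ s}

/-- `MajorizedBy g f` is the relation `g ≺ f` for (bounded measurable) functions on `[0,1]`. -/
def MajorizedBy (g f : ℝ → ℝ) : Prop :=
  (∀ t ∈ Set.Icc (0 : ℝ) 1, (∫ x in (0 : ℝ)..t, g x) ≤ ∫ x in (0 : ℝ)..t, f x) ∧
    (∫ x in (0 : ℝ)..1, g x) = ∫ x in (0 : ℝ)..1, f x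

/-- The `C`-numerical range `V_C(T) = {τ(TX) | X ∈ M self-adjoint, λ_X ≺ λ_C}`. -/
def numericalRange (τ : TracialState M) (C T : M.toStarSubalgebra) : Set ℂ :=
  {z | ∃ X : M.toStarSubalgebra, IsSelfAdjoint X ∧
    MajorizedBy (eigenvalueFun τ X) (eigenvalueFun τ C) ∧ τ (T * X) = z}

end

end CNumericalRange

/-! Everything rests on a description of `λ_X ≺ λ_C` that avoids eigenvalue functions. Legendre
duality gives `∫₀ᵗ λ_X = min_k (t k + τ((X - k)₊))` (`isLeast_kyFan`), and `τ((X - k)₊)` is the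
largest value of `τ((X - k) q)` over projections `q` (`re_mul_le_excess`). Hence these integrals are
sublinear in `X`, do not increase under unitary conjugation, and `X ↦ -X` reflects `t` to `1 - t`;
at `t = 1` they give the trace.

So the set of admissible `X` is convex and unitarily invariant, all its members have trace `τ(C)`,
and real affine maps `aX + b` carry majorization by `C` to majorization by `aC + b`. The claims on
`V_C` follow by linearity, traciality and `τ(x*) = conj τ(x)`. Only the degenerate case `a = 0` of
the affine rule needs faithfulness: a scalar majorizes nothing but itself. -/

namespace CNumericalRange

open Set MeasureTheory Filter Topology

/-! ### Real analysis: Legendre duality for generalized inverses. -/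

/-- A function with a bounded supergradient `g` on `[0,1]` is the integral of `g`. -/
theorem integral_eq_sub_of_supergradient {K g : ℝ → ℝ} {B : ℝ}
    (hK : ∀ s ∈ Icc (0 : ℝ) 1, ∀ t ∈ Icc (0 : ℝ) 1, K s ≤ K t + (s - t) * g t)
    (hB : ∀ t ∈ Icc (0 : ℝ) 1, |g t| ≤ B) {t : ℝ} (ht : t ∈ Icc (0 : ℝ) 1) :
    ∫ x in (0 : ℝ)..t, g x = K t - K 0 := by
  have hanti : AntitoneOn g (Icc 0 1) := by
    intro a ha b hb hab
    rcases hab.eq_or_lt with rfl | hlt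
    · rfl
    · nlinarith [hK a ha b hb, hK b hb a ha]
  have hsubset : Icc (0 : ℝ) t ⊆ Icc 0 1 := Icc_subset_Icc_right ht.2
  -- A monotone `g` has countably many discontinuities, and `K' = g` at every interior point of
  -- continuity.
  refine integral_eq_of_hasDerivAt_off_countable_of_le K g ht.1
    (hanti.countable_not_continuousWithinAt) ?_ ?_ ?_
  · have hL : LipschitzOnWith (Real.toNNReal B) K (Icc 0 1) := by
      refine LipschitzOnWith.of_dist_le_mul fun a ha b hb => ?_
      have hB0 : 0 ≤ B := (abs_nonneg _).trans (hB a ha)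
      rw [Real.coe_toNNReal _ hB0, Real.dist_eq, Real.dist_eq]
      have h1 : (a - b) * g b ≤ B * |a - b| := by
        calc (a - b) * g b ≤ |(a - b) * g b| := le_abs_self _
          _ = |g b| * |a - b| := by rw [abs_mul, mul_comm]
          _ ≤ _ := by gcongr; exact hB b hb
      have h2 : (b - a) * g a ≤ B * |a - b| := by
        calc (b - a) * g a ≤ |(b - a) * g a| := le_abs_self _
          _ = |g a| * |a - b| := by rw [abs_mul, mul_comm, abs_sub_comm]
          _ ≤ _ := by gcongr; exact hB a ha
      rw [abs_le]
      constructor <;> linarith [hK a ha b hb, hK b hb a ha]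
    exact hL.continuousOn.mono hsubset
  · rintro x ⟨hx, hxc⟩
    have hx1 : x ∈ Ioo (0 : ℝ) 1 := ⟨hx.1, hx.2.trans_le ht.2⟩
    have hxI := Ioo_subset_Icc_self hx1
    have hnhds : Icc (0 : ℝ) 1 ∈ 𝓝 x := Icc_mem_nhds hx1.1 hx1.2
    have hc : ContinuousAt g x := by
      by_contra h
      exact hxc ⟨hxI, fun h' => h (h'.continuousAt hnhds)⟩
    rw [hasDerivAt_iff_isLittleO, Asymptotics.isLittleO_iff]
    intro ε hε
    filter_upwards [hnhds, Metric.continuousAt_iff'.1 hc ε hε] with y hy hyε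
    rw [Real.dist_eq] at hyε
    have h1 : |(y - x) * (g y - g x)| ≤ ε * |y - x| := by
      rw [abs_mul, mul_comm]; gcongr
    rw [Real.norm_eq_abs, Real.norm_eq_abs, smul_eq_mul, abs_le]
    have h2 := abs_le.1 h1
    constructor <;> nlinarith [hK y hy x hxI, hK x hxI y hy, h2.1, h2.2]
  · apply AntitoneOn.intervalIntegrable
    rw [uIcc_of_le ht.1]
    exact hanti.mono hsubset

/-- Legendre duality: if `-d` is a subgradient of `F`, the integral of the generalized inverse of
`d` is the infimum of `k ↦ t * k + F k`. -/
theorem isLeast_integral_generalizedInverse {F d : ℝ → ℝ} {R m : ℝ}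
    (hsub : ∀ k k', F k - d k * (k' - k) ≤ F k') (hd0 : ∀ k, 0 ≤ d k) (hd1 : ∀ k, d k ≤ 1)
    (hR : ∀ k, R ≤ k → F k = 0) (hR' : ∀ k, k ≤ -R → F k = m - k)
    {t : ℝ} (ht : t ∈ Icc (0 : ℝ) 1) :
    IsLeast (range fun k => t * k + F k) (∫ x in (0 : ℝ)..t, sInf {k : ℝ | d k ≤ x}) := by
  have hmem : ∀ x, 0 ≤ x → R + 1 ∈ {k : ℝ | d k ≤ x} := by
    intro x hx
    have := hsub (R + 1) R
    rw [hR _ le_rfl, hR (R + 1) (by linarith)] at this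
    change d (R + 1) ≤ x
    linarith
  have hlow : ∀ x, x < 1 → ∀ k ∈ {k : ℝ | d k ≤ x}, -R ≤ k := by
    intro x hx k hk
    by_contra! hlt
    have := hsub k (-R)
    rw [hR' _ le_rfl, hR' k hlt.le] at this
    have hk' : d k ≤ x := hk
    nlinarith
  -- At `x = 1` the set is all of `ℝ` and `sInf` takes a junk value; `-R` is a true minimizer of `k
  -- + F k` there.
  set g : ℝ → ℝ := fun x => if x < 1 then sInf {k : ℝ | d k ≤ x} else -R with hg
  have hgmin : ∀ x ∈ Icc (0 : ℝ) 1, ∀ k, x * g x + F (g x) ≤ x * k + F k := by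
    intro x hx k
    by_cases hx1 : x < 1
    · have hgx : g x = sInf {k : ℝ | d k ≤ x} := if_pos hx1
      have hne : {k : ℝ | d k ≤ x}.Nonempty := ⟨_, hmem x hx.1⟩
      have hbdd : BddBelow {k : ℝ | d k ≤ x} := ⟨_, hlow x hx1⟩
      -- The infimum need not be attained, so the slope condition is used at some `k'` within `ε` of
      -- `g x`.
      refine le_of_forall_pos_le_add fun ε hε => ?_
      rcases lt_trichotomy k (g x) with hlt | heq | hlt
      · obtain ⟨k', hk1, hk2⟩ := exists_between (max_lt hlt (sub_lt_self (g x) hε))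
        rw [max_lt_iff] at hk1
        have hdk : x < d k' := by
          by_contra! h
          exact absurd (csInf_le hbdd h) (not_le.2 (hgx ▸ hk2))
        nlinarith [hsub k' k, hsub (g x) k', hd0 (g x), hx.1]
      · rw [heq]; linarith
      · have : g x < min k (g x + ε) := lt_min hlt (by linarith)
        rw [hgx] at this
        obtain ⟨k', hk, hk'⟩ := exists_lt_of_csInf_lt hne this
        have hk1 := csInf_le hbdd hk
        rw [← hgx] at hk1 hk'
        rw [lt_min_iff] at hk'
        have hdk : d k' ≤ x := hk
        nlinarith [hsub k' k, hsub (g x) k', hd1 (g x), hx.1]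
    · have hgx : g x = -R := if_neg hx1
      have hx1 : x = 1 := le_antisymm hx.2 (not_lt.1 hx1)
      rw [hgx, hx1, hR' _ le_rfl]
      rcases le_total k (-R) with h | h
      · rw [hR' k h]; linarith
      · have := hsub (-R) k
        rw [hR' _ le_rfl] at this
        nlinarith [hd1 (-R)]
  have hgB : ∀ x ∈ Icc (0 : ℝ) 1, |g x| ≤ |R| + 1 := by
    intro x hx
    by_cases hx1 : x < 1
    · have hgx : g x = sInf {k : ℝ | d k ≤ x} := if_pos hx1
      have h1 : g x ≤ R + 1 := hgx ▸ csInf_le ⟨_, hlow x hx1⟩ (hmem x hx.1)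
      have h2 : -R ≤ g x := hgx ▸ le_csInf ⟨_, hmem x hx.1⟩ (hlow x hx1)
      rw [abs_le]
      constructor <;> linarith [le_abs_self R]
    · rw [show g x = -R from if_neg hx1, abs_neg]; linarith
  have hint : ∫ x in (0 : ℝ)..t, sInf {k : ℝ | d k ≤ x} = ∫ x in (0 : ℝ)..t, g x := by
    refine intervalIntegral.integral_congr_ae ?_
    filter_upwards [compl_mem_ae_iff.2 (measure_singleton (1 : ℝ))] with x hx hxt
    rw [uIoc_of_le ht.1] at hxt
    exact (if_pos (lt_of_le_of_ne (hxt.2.trans ht.2) hx)).symm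
  have hK0 : (0 : ℝ) * g 0 + F (g 0) = 0 := by
    refine le_antisymm ?_ ?_
    · simpa [hR R le_rfl] using hgmin 0 (by simp) R
    · have := hsub (max R (g 0)) (g 0)
      rw [hR _ (le_max_left _ _)] at this
      nlinarith [hd0 (max R (g 0)), le_max_right R (g 0)]
  rw [hint, integral_eq_sub_of_supergradient (K := fun x => x * g x + F (g x)) ?_ hgB ht]
  · simp only [hK0, sub_zero]
    exact ⟨⟨g t, rfl⟩, by rintro _ ⟨k, rfl⟩; exact hgmin t ht k⟩
  · intro a ha b hb
    have := hgmin a ha (g b)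
    linarith

/-! ### Spectral projections and positive parts of operators. -/

section Operator

variable {H : Type*} [NormedAddCommGroup H] [InnerProductSpace ℂ H] [CompleteSpace H]

theorem isStarProjection_spectralProjIoi (T : H →L[ℂ] H) (t : ℝ) :
    IsStarProjection (spectralProjIoi T t) :=
  isStarProjection_starProjection

theorem sub_smul_one_eq_cfc {T : H →L[ℂ] H} (hT : IsSelfAdjoint T) (t : ℝ) :
    T - (t : ℂ) • 1 = cfc (fun x : ℝ => x - t) T := by
  rw [cfc_sub (fun x : ℝ => x) (fun _ => t) T, cfc_id' ℝ T, cfc_const t T,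
    Algebra.algebraMap_eq_smul_one, Complex.coe_smul]

/-- `(T - t) 1_{(t,∞)}(T) = (T - t)₊`. -/
theorem sub_smul_one_mul_spectralProjIoi {T : H →L[ℂ] H} (hT : IsSelfAdjoint T) (t : ℝ) :
    (T - (t : ℂ) • 1) * spectralProjIoi T t = cfc (fun x : ℝ => max (x - t) 0) T := by
  set N := cfc (fun x : ℝ => max (x - t) 0) T with hN
  have hNsa : IsSelfAdjoint N := cfc_predicate _ _
  have hPN : spectralProjIoi T t * N = N := by
    ext v
    exact Submodule.starProjection_eq_self_iff.2
      (Submodule.le_topologicalClosure _ (LinearMap.mem_range_self _ v))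
  have hNP : N * spectralProjIoi T t = N := by
    have := congrArg star hPN
    rwa [star_mul, hNsa.star_eq,
      (isStarProjection_spectralProjIoi T t).isSelfAdjoint.star_eq] at this
  -- The negative part annihilates the positive part, hence also the closure of its range, onto
  -- which the projection maps.
  have hzero : (T - (t : ℂ) • 1 - N) * N = 0 := by
    rw [sub_smul_one_eq_cfc hT, hN, ← cfc_sub (fun x : ℝ => x - t) (fun x : ℝ => max (x - t) 0) T, ← cfc_mul _ _ T]
    refine (cfc_congr (g := fun _ => 0) fun x _ => ?_).trans (cfc_const_zero ℝ T)
    rcases le_total (x - t) 0 with h | h <;> simp [h]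
  have hzeroP : (T - (t : ℂ) • 1 - N) * spectralProjIoi T t = 0 := by
    ext v
    have hle : N.range.topologicalClosure ≤ (T - (t : ℂ) • 1 - N).ker := by
      refine Submodule.topologicalClosure_minimal _ ?_
        (ContinuousLinearMap.isClosed_ker (T - (t : ℂ) • 1 - N))
      rintro _ ⟨w, rfl⟩
      exact congrArg (fun A : H →L[ℂ] H => A w) hzero
    exact hle (Submodule.starProjection_apply_mem _ v)
  rw [sub_mul, sub_eq_zero, hNP] at hzeroP
  exact hzeroP

theorem sub_smul_one_mul_spectralProjIoi_nonneg {T : H →L[ℂ] H} (hT : IsSelfAdjoint T) (t : ℝ) :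
    0 ≤ (T - (t : ℂ) • 1) * spectralProjIoi T t := by
  rw [sub_smul_one_mul_spectralProjIoi hT]
  exact cfc_nonneg fun x _ => le_max_right _ _

theorem sub_smul_one_le_mul_spectralProjIoi {T : H →L[ℂ] H} (hT : IsSelfAdjoint T) (t : ℝ) :
    T - (t : ℂ) • 1 ≤ (T - (t : ℂ) • 1) * spectralProjIoi T t := by
  rw [sub_smul_one_mul_spectralProjIoi hT]
  rw [sub_smul_one_eq_cfc hT]
  exact cfc_mono fun x _ => le_max_left _ _

theorem mul_self_le_norm_smul {B : H →L[ℂ] H} (hB : 0 ≤ B) : B * B ≤ (‖B‖ : ℂ) • B := by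
  have hsa : IsSelfAdjoint B := IsSelfAdjoint.of_nonneg hB
  have h1 : B * B = cfc (fun x : ℝ => x * x) B := by
    rw [cfc_mul (fun x : ℝ => x) (fun x : ℝ => x) B, cfc_id' ℝ B]
  have h2 : (‖B‖ : ℂ) • B = cfc (fun x : ℝ => ‖B‖ * x) B := by
    rw [cfc_const_mul ‖B‖ (fun x : ℝ => x) B, cfc_id' ℝ B, Complex.coe_smul]
  rw [h1, h2]
  refine cfc_mono fun x hx => ?_
  have h0 : 0 ≤ x := spectrum_nonneg_of_nonneg hB hx
  have h3 : x ≤ ‖B‖ := (le_abs_self x).trans (by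
    refine (spectrum.norm_le_norm_mul_of_mem hx).trans ?_
    exact mul_le_of_le_one_right (norm_nonneg _) ContinuousLinearMap.norm_id_le)
  gcongr

end Operator

/-! ### Order properties of the tracial state. -/

section Trace

variable {H : Type*} [NormedAddCommGroup H] [InnerProductSpace ℂ H] [CompleteSpace H]
  {M : VonNeumannAlgebra H} (τ : TracialState M)

namespace TracialState

theorem map_one : τ 1 = 1 := τ.map_one'

theorem map_mul_comm (x y : M.toStarSubalgebra) : τ (x * y) = τ (y * x) := τ.tracial' x y

theorem re_nonneg {x : M.toStarSubalgebra} (hx : 0 ≤ x) : 0 ≤ (τ x).re :=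
  (Complex.nonneg_iff.1 (τ.nonneg' x hx)).1

theorem re_mono {x y : M.toStarSubalgebra} (h : x ≤ y) : (τ x).re ≤ (τ y).re := by
  have := τ.re_nonneg (sub_nonneg.2 h)
  rw [map_sub, Complex.sub_re] at this
  linarith

theorem re_smul (k : ℝ) (x : M.toStarSubalgebra) : (τ ((k : ℂ) • x)).re = k * (τ x).re := by
  rw [map_smul, smul_eq_mul, Complex.re_ofReal_mul]

end TracialState

theorem le_norm_smul_one {x : M.toStarSubalgebra} (hx : IsSelfAdjoint x) :
    x ≤ (‖x‖ : ℂ) • (1 : M.toStarSubalgebra) := by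
  have hx' : IsSelfAdjoint (x : H →L[ℂ] H) := congrArg Subtype.val hx
  have := hx'.le_algebraMap_norm_self
  rw [Algebra.algebraMap_eq_smul_one, ← Complex.coe_smul] at this
  exact this

namespace TracialState

/-- Nonnegativity in `ℂ` includes being real, and `‖x‖ - x` is positive while `τ(1) = 1`. -/
theorem im_eq_zero {x : M.toStarSubalgebra} (hx : IsSelfAdjoint x) : (τ x).im = 0 := by
  have h := τ.nonneg' _ (sub_nonneg.2 (le_norm_smul_one hx))
  have h2 := (Complex.nonneg_iff.1 h).2
  change (0 : ℝ) = (τ (_ - x)).im at h2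
  rw [map_sub, map_smul, τ.map_one] at h2
  simpa using h2

theorem map_star (x : M.toStarSubalgebra) : τ (star x) = starRingEnd ℂ (τ x) := by
  have hr : starRingEnd ℂ (τ (ℜ x : M.toStarSubalgebra)) = τ (ℜ x : M.toStarSubalgebra) :=
    Complex.conj_eq_iff_im.2 (τ.im_eq_zero (ℜ x).2)
  have hi : starRingEnd ℂ (τ (ℑ x : M.toStarSubalgebra)) = τ (ℑ x : M.toStarSubalgebra) :=
    Complex.conj_eq_iff_im.2 (τ.im_eq_zero (ℑ x).2)
  have h1 : star x = (ℜ x : M.toStarSubalgebra) - Complex.I • (ℑ x : M.toStarSubalgebra) := by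
    conv_lhs => rw [← realPart_add_I_smul_imaginaryPart x]
    rw [star_add, star_smul, (ℜ x).2.star_eq, (ℑ x).2.star_eq]
    simp [sub_eq_add_neg]
  rw [h1]
  conv_rhs => rw [← realPart_add_I_smul_imaginaryPart x]
  rw [map_sub, map_add, map_smul, map_add, smul_eq_mul, map_mul, hr, hi, Complex.conj_I]
  ring

/-- Traciality turns `xq` into the positive element `qxq`. -/
theorem re_mul_isStarProjection {x q : M.toStarSubalgebra} (hx : 0 ≤ x) (hq : IsStarProjection q) :
    0 ≤ (τ (x * q)).re := by
  have h : τ (x * q) = τ (star q * x * q) := by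
    rw [hq.isSelfAdjoint.star_eq, mul_assoc, τ.map_mul_comm q, mul_assoc, hq.isIdempotentElem.eq]
  rw [h]
  exact τ.re_nonneg (star_left_conjugate_nonneg (R := H →L[ℂ] H) hx q)

theorem re_mul_le_of_isStarProjection {x q : M.toStarSubalgebra} (hx : 0 ≤ x)
    (hq : IsStarProjection q) : (τ (x * q)).re ≤ (τ x).re := by
  have := τ.re_mul_isStarProjection hx hq.one_sub
  rw [mul_sub, mul_one, map_sub, Complex.sub_re] at this
  linarith

/-- Faithfulness speaks of `x* x`, and here `0 ≤ x² ≤ ‖x‖ x`. -/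
theorem eq_zero_of_nonneg {x : M.toStarSubalgebra} (hx : 0 ≤ x) (h : (τ x).re = 0) : x = 0 := by
  have hsa : IsSelfAdjoint x := Subtype.ext (IsSelfAdjoint.of_nonneg (R := H →L[ℂ] H) hx).star_eq
  apply τ.faithful'
  rw [hsa.star_eq]
  change τ (x * x) = 0
  have h1 : x * x ≤ (‖x‖ : ℂ) • x := mul_self_le_norm_smul (B := (x : H →L[ℂ] H)) hx
  have h2 := τ.re_mono h1
  rw [τ.re_smul, h, mul_zero] at h2
  have hsa2 : IsSelfAdjoint (x * x) := by
    rw [IsSelfAdjoint, star_mul, hsa.star_eq]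
  have h3 : 0 ≤ x * x := by
    have := star_mul_self_nonneg (x : H →L[ℂ] H)
    rw [(IsSelfAdjoint.of_nonneg (R := H →L[ℂ] H) hx).star_eq] at this
    exact this
  exact Complex.ext (le_antisymm h2 (τ.re_nonneg h3)) (τ.im_eq_zero hsa2)

end TracialState

end Trace

/-! ### The function `k ↦ τ((X - k)₊)`. -/

noncomputable section Excess

open Set

variable {H : Type*} [NormedAddCommGroup H] [InnerProductSpace ℂ H] [CompleteSpace H]
  {M : VonNeumannAlgebra H} (τ : TracialState M)

/-- The spectral projection `1_{(t,∞)}(X)` as an element of the algebra. -/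
def spectralProj (X : M.toStarSubalgebra) (t : ℝ) : M.toStarSubalgebra :=
  ⟨spectralProjIoi (X : H →L[ℂ] H) t, spectralProjIoi_mem M X.2 t⟩

/-- `τ((X - k)₊)`, written as `τ((X - k) 1_{(k,∞)}(X))`. -/
def excess (X : M.toStarSubalgebra) (k : ℝ) : ℝ :=
  (τ ((X - (k : ℂ) • 1) * spectralProj X k)).re

theorem isStarProjection_spectralProj (X : M.toStarSubalgebra) (t : ℝ) :
    IsStarProjection (spectralProj X t) where
  isIdempotentElem :=
    Subtype.ext (isStarProjection_spectralProjIoi (X : H →L[ℂ] H) t).isIdempotentElem.eq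
  isSelfAdjoint :=
    Subtype.ext (isStarProjection_spectralProjIoi (X : H →L[ℂ] H) t).isSelfAdjoint.star_eq

theorem zero_le_one_toStarSubalgebra : (0 : M.toStarSubalgebra) ≤ 1 :=
  zero_le_one (α := H →L[ℂ] H)

theorem ofReal_smul_one_nonneg {c : ℝ} (hc : 0 ≤ c) :
    0 ≤ (c : ℂ) • (1 : M.toStarSubalgebra) :=
  smul_nonneg (β := H →L[ℂ] H) (Complex.zero_le_real.2 hc) zero_le_one

theorem re_nonneg_of_isStarProjection {q : M.toStarSubalgebra} (hq : IsStarProjection q) :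
    0 ≤ (τ q).re := by
  simpa using τ.re_mul_isStarProjection zero_le_one_toStarSubalgebra hq

theorem re_le_one_of_isStarProjection {q : M.toStarSubalgebra} (hq : IsStarProjection q) :
    (τ q).re ≤ 1 := by
  simpa [τ.map_one] using τ.re_mul_le_of_isStarProjection zero_le_one_toStarSubalgebra hq

variable {X Y : M.toStarSubalgebra}

theorem sub_mul_spectralProj_nonneg (hX : IsSelfAdjoint X) (k : ℝ) :
    0 ≤ (X - (k : ℂ) • 1) * spectralProj X k :=
  sub_smul_one_mul_spectralProjIoi_nonneg (T := (X : H →L[ℂ] H)) (congrArg Subtype.val hX) k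

theorem sub_le_mul_spectralProj (hX : IsSelfAdjoint X) (k : ℝ) :
    X - (k : ℂ) • 1 ≤ (X - (k : ℂ) • 1) * spectralProj X k :=
  sub_smul_one_le_mul_spectralProjIoi (T := (X : H →L[ℂ] H)) (congrArg Subtype.val hX) k

theorem excess_nonneg (hX : IsSelfAdjoint X) (k : ℝ) : 0 ≤ excess τ X k :=
  τ.re_nonneg (sub_mul_spectralProj_nonneg hX k)

/-- Variational characterization of `τ((X - k)₊)`. -/
theorem re_mul_le_excess (hX : IsSelfAdjoint X) (k : ℝ) {q : M.toStarSubalgebra}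
    (hq : IsStarProjection q) : (τ ((X - (k : ℂ) • 1) * q)).re ≤ excess τ X k := by
  -- `τ((X - k) q) ≤ τ((X - k)₊ q) ≤ τ((X - k)₊)`.
  have h1 := τ.re_mul_isStarProjection (sub_nonneg.2 (sub_le_mul_spectralProj hX k)) hq
  have h2 := τ.re_mul_le_of_isStarProjection (sub_mul_spectralProj_nonneg hX k) hq
  rw [sub_mul, map_sub, Complex.sub_re] at h1
  exact (sub_nonneg.1 h1).trans h2

theorem re_sub_smul_one (X : M.toStarSubalgebra) (k : ℝ) :
    (τ (X - (k : ℂ) • 1)).re = (τ X).re - k := by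
  rw [map_sub, Complex.sub_re, τ.re_smul, τ.map_one, Complex.one_re, mul_one]

theorem re_sub_le_excess (hX : IsSelfAdjoint X) (k : ℝ) : (τ X).re - k ≤ excess τ X k := by
  rw [← re_sub_smul_one]
  exact τ.re_mono (sub_le_mul_spectralProj hX k)

theorem excess_eq_zero (hX : IsSelfAdjoint X) {k : ℝ} (hk : ‖X‖ ≤ k) : excess τ X k = 0 := by
  refine le_antisymm ?_ (excess_nonneg τ hX k)
  have hle : X ≤ (k : ℂ) • 1 := by
    refine (le_norm_smul_one hX).trans (sub_nonneg.1 ?_)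
    rw [← sub_smul, ← Complex.ofReal_sub]
    exact ofReal_smul_one_nonneg (sub_nonneg.2 hk)
  have := τ.re_mul_isStarProjection (sub_nonneg.2 hle) (isStarProjection_spectralProj X k)
  rw [← neg_sub, neg_mul, map_neg, Complex.neg_re] at this
  exact neg_nonneg.1 this

theorem excess_eq_sub (hX : IsSelfAdjoint X) {k : ℝ} (hk : k ≤ -‖X‖) :
    excess τ X k = (τ X).re - k := by
  refine le_antisymm ?_ (re_sub_le_excess τ hX k)
  have hle : 0 ≤ X - (k : ℂ) • 1 := by
    have h1 := le_norm_smul_one hX.neg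
    rw [norm_neg] at h1
    have h2 : 0 ≤ ((-k - ‖X‖ : ℝ) : ℂ) • (1 : M.toStarSubalgebra) :=
      ofReal_smul_one_nonneg (by linarith)
    have h3 : X - (k : ℂ) • (1 : M.toStarSubalgebra)
        = ((‖X‖ : ℂ) • (1 : M.toStarSubalgebra) - -X) + ((-k - ‖X‖ : ℝ) : ℂ) • 1 := by
      push_cast
      module
    rw [h3]
    exact add_nonneg (sub_nonneg.2 h1) h2
  rw [← re_sub_smul_one]
  exact τ.re_mul_le_of_isStarProjection hle (isStarProjection_spectralProj X k)

/-- The spectral projection at `k` serves as trial projection at `k'`. -/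
theorem excess_subgradient (hX : IsSelfAdjoint X) (k k' : ℝ) :
    excess τ X k - (τ (spectralProj X k)).re * (k' - k) ≤ excess τ X k' := by
  refine le_trans (le_of_eq ?_) (re_mul_le_excess τ hX k' (isStarProjection_spectralProj X k))
  have : (X - (k' : ℂ) • 1) * spectralProj X k
      = (X - (k : ℂ) • 1) * spectralProj X k - ((k' - k : ℝ) : ℂ) • spectralProj X k := by
    simp only [sub_mul, smul_mul_assoc, one_mul]
    push_cast
    module
  rw [this, map_sub, Complex.sub_re, τ.re_smul, excess, mul_comm]

/-! ### Partial integrals of the eigenvalue function. -/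

/-- The partial integral `∫₀ᵗ λ_X` of the eigenvalue function. -/
def kyFan (X : M.toStarSubalgebra) (t : ℝ) : ℝ := ∫ x in (0 : ℝ)..t, eigenvalueFun τ X x

/-- The eigenvalue function is by definition the generalized inverse of `k ↦ τ(1_{(k,∞)}(X))`, so
the duality applies with `R = ‖X‖` and `m = τ(X)`. -/
theorem isLeast_kyFan (hX : IsSelfAdjoint X) {t : ℝ} (ht : t ∈ Icc (0 : ℝ) 1) :
    IsLeast (range fun k => t * k + excess τ X k) (kyFan τ X t) :=
  isLeast_integral_generalizedInverse (d := fun k => (τ (spectralProj X k)).re)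
    (excess_subgradient τ hX)
    (fun k => re_nonneg_of_isStarProjection τ (isStarProjection_spectralProj X k))
    (fun k => re_le_one_of_isStarProjection τ (isStarProjection_spectralProj X k))
    (fun _ => excess_eq_zero τ hX) (fun _ => excess_eq_sub τ hX) ht

theorem kyFan_le (hX : IsSelfAdjoint X) {t : ℝ} (ht : t ∈ Icc (0 : ℝ) 1) (k : ℝ) :
    kyFan τ X t ≤ t * k + excess τ X k :=
  (isLeast_kyFan τ hX ht).2 ⟨k, rfl⟩

theorem exists_kyFan_eq (hX : IsSelfAdjoint X) {t : ℝ} (ht : t ∈ Icc (0 : ℝ) 1) :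
    ∃ k, t * k + excess τ X k = kyFan τ X t :=
  (isLeast_kyFan τ hX ht).1

theorem kyFan_one (hX : IsSelfAdjoint X) : kyFan τ X 1 = (τ X).re := by
  have h1 : (1 : ℝ) ∈ Icc (0 : ℝ) 1 := by simp
  apply le_antisymm
  · have := kyFan_le τ hX h1 (-‖X‖)
    rw [excess_eq_sub τ hX le_rfl] at this
    linarith
  · obtain ⟨k, hk⟩ := exists_kyFan_eq τ hX h1
    linarith [re_sub_le_excess τ hX k]

/-- With `t = τ(1_{(k,∞)}(X))`, the subgradient inequality says that `k` itself attains the dual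
minimum. -/
theorem kyFan_spectralProj (hX : IsSelfAdjoint X) (k : ℝ) :
    excess τ X k ≤ kyFan τ X (τ (spectralProj X k)).re - (τ (spectralProj X k)).re * k := by
  obtain ⟨k', hk'⟩ := exists_kyFan_eq τ hX
    (t := (τ (spectralProj X k)).re)
    ⟨re_nonneg_of_isStarProjection τ (isStarProjection_spectralProj X k),
      re_le_one_of_isStarProjection τ (isStarProjection_spectralProj X k)⟩
  linarith [excess_subgradient τ hX k k']

theorem isSelfAdjoint_ofReal_smul (hX : IsSelfAdjoint X) (a : ℝ) :
    IsSelfAdjoint ((a : ℂ) • X) := by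
  rw [IsSelfAdjoint, star_smul, hX.star_eq, Complex.star_def, Complex.conj_ofReal]

/-- Sublinearity of the partial integrals of the eigenvalue function. -/
theorem kyFan_add_le (hX : IsSelfAdjoint X) (hY : IsSelfAdjoint Y) {a b : ℝ} (ha : 0 ≤ a)
    (hb : 0 ≤ b) {t : ℝ} (ht : t ∈ Icc (0 : ℝ) 1) :
    kyFan τ ((a : ℂ) • X + (b : ℂ) • Y) t ≤ a * kyFan τ X t + b * kyFan τ Y t := by
  obtain ⟨k, hk⟩ := exists_kyFan_eq τ hX ht
  obtain ⟨l, hl⟩ := exists_kyFan_eq τ hY ht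
  have hZ := (isSelfAdjoint_ofReal_smul hX a).add (isSelfAdjoint_ofReal_smul hY b)
  -- Combining the two optimal thresholds lets one projection be tested against `X - k` and `Y - l`
  -- simultaneously.
  refine (kyFan_le τ hZ ht (a * k + b * l)).trans ?_
  set Z := (a : ℂ) • X + (b : ℂ) • Y
  have hq := isStarProjection_spectralProj Z (a * k + b * l)
  have key : excess τ Z (a * k + b * l) ≤ a * excess τ X k + b * excess τ Y l := by
    have h : (Z - ((a * k + b * l : ℝ) : ℂ) • 1) * spectralProj Z (a * k + b * l)
        = (a : ℂ) • ((X - (k : ℂ) • 1) * spectralProj Z (a * k + b * l))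
          + (b : ℂ) • ((Y - (l : ℂ) • 1) * spectralProj Z (a * k + b * l)) := by
      rw [← smul_mul_assoc, ← smul_mul_assoc, ← add_mul]
      congr 1
      simp only [Z]
      push_cast
      module
    rw [excess, h, map_add, Complex.add_re, τ.re_smul, τ.re_smul]
    gcongr
    · exact re_mul_le_excess τ hX k hq
    · exact re_mul_le_excess τ hY l hq
  rw [← hk, ← hl]
  linarith

theorem kyFan_smul_one_le (b : ℝ) {t : ℝ} (ht : t ∈ Icc (0 : ℝ) 1) :
    kyFan τ ((b : ℂ) • 1) t ≤ t * b := by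
  refine (kyFan_le τ (isSelfAdjoint_ofReal_smul (IsSelfAdjoint.one _) b) ht b).trans (le_of_eq ?_)
  simp [excess]

theorem kyFan_smul_add_smul_one_le (hX : IsSelfAdjoint X) {a : ℝ} (ha : 0 ≤ a) (b : ℝ) {t : ℝ}
    (ht : t ∈ Icc (0 : ℝ) 1) :
    kyFan τ ((a : ℂ) • X + (b : ℂ) • 1) t ≤ a * kyFan τ X t + t * b := by
  have := kyFan_add_le τ hX (isSelfAdjoint_ofReal_smul (IsSelfAdjoint.one _) b) ha zero_le_one ht
  rw [Complex.ofReal_one, one_smul] at this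
  linarith [kyFan_smul_one_le τ b ht]

theorem kyFan_smul_add_smul_one (hX : IsSelfAdjoint X) {a : ℝ} (ha : 0 < a) (b : ℝ) {t : ℝ}
    (ht : t ∈ Icc (0 : ℝ) 1) :
    kyFan τ ((a : ℂ) • X + (b : ℂ) • 1) t = a * kyFan τ X t + t * b := by
  refine le_antisymm (kyFan_smul_add_smul_one_le τ hX ha.le b ht) ?_
  have hZ := (isSelfAdjoint_ofReal_smul hX a).add
    (isSelfAdjoint_ofReal_smul (IsSelfAdjoint.one _) b)
  -- The reverse inequality is the same bound for the inverse affine map.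
  have h := kyFan_smul_add_smul_one_le τ hZ (inv_nonneg.2 ha.le) (-(a⁻¹ * b)) ht
  have ha' : (a : ℂ) ≠ 0 := Complex.ofReal_ne_zero.2 ha.ne'
  have hX' : ((a⁻¹ : ℝ) : ℂ) • ((a : ℂ) • X + (b : ℂ) • (1 : M.toStarSubalgebra))
      + ((-(a⁻¹ * b) : ℝ) : ℂ) • 1 = X := by
    push_cast
    rw [smul_add, smul_smul, smul_smul, inv_mul_cancel₀ ha', one_smul, add_assoc, ← add_smul,
      add_neg_cancel, zero_smul, add_zero]
  rw [hX'] at h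
  have h2 := mul_le_mul_of_nonneg_left h ha.le
  have h3 : a * (a⁻¹ * kyFan τ ((a : ℂ) • X + (b : ℂ) • 1) t + t * -(a⁻¹ * b))
      = kyFan τ ((a : ℂ) • X + (b : ℂ) • 1) t - t * b := by
    field_simp
    ring
  linarith

/-- The complement of the spectral projection of `-X` at `-k` is a trial projection for `X` at `k`.
-/
theorem kyFan_neg_le (hX : IsSelfAdjoint X) {t : ℝ} (ht : t ∈ Icc (0 : ℝ) 1) :
    kyFan τ (-X) t ≤ kyFan τ X (1 - t) - (τ X).re := by
  have ht' : 1 - t ∈ Icc (0 : ℝ) 1 := ⟨by linarith [ht.2], by linarith [ht.1]⟩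
  obtain ⟨k, hk⟩ := exists_kyFan_eq τ hX ht'
  refine (kyFan_le τ hX.neg ht (-k)).trans ?_
  have hq := isStarProjection_spectralProj (-X) (-k)
  have h := re_mul_le_excess τ hX k hq.one_sub
  have h2 : (X - (k : ℂ) • 1) * (1 - spectralProj (-X) (-k))
      = (X - (k : ℂ) • 1) + (-X - ((-k : ℝ) : ℂ) • 1) * spectralProj (-X) (-k) := by
    have : -X - ((-k : ℝ) : ℂ) • (1 : M.toStarSubalgebra) = -(X - (k : ℂ) • 1) := by
      push_cast
      module
    rw [this, mul_sub, mul_one, neg_mul, sub_eq_add_neg]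
  rw [h2, map_add, Complex.add_re, re_sub_smul_one] at h
  change _ + excess τ (-X) (-k) ≤ _ at h
  linarith

theorem kyFan_neg (hX : IsSelfAdjoint X) {t : ℝ} (ht : t ∈ Icc (0 : ℝ) 1) :
    kyFan τ (-X) t = kyFan τ X (1 - t) - (τ X).re := by
  refine le_antisymm (kyFan_neg_le τ hX ht) ?_
  have ht' : 1 - t ∈ Icc (0 : ℝ) 1 := ⟨by linarith [ht.2], by linarith [ht.1]⟩
  have := kyFan_neg_le τ hX.neg ht'
  rw [neg_neg, sub_sub_cancel, map_neg, Complex.neg_re] at this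
  linarith

/-- The spectral projection of the conjugate, pulled back by `U`, is a trial projection for `X`. -/
theorem kyFan_conj_le (hX : IsSelfAdjoint X) {U : M.toStarSubalgebra} (hU : U ∈ unitary _)
    {t : ℝ} (ht : t ∈ Icc (0 : ℝ) 1) : kyFan τ (U * X * star U) t ≤ kyFan τ X t := by
  obtain ⟨k, hk⟩ := exists_kyFan_eq τ hX ht
  rw [← hk]
  refine (kyFan_le τ (hX.conjugate U) ht k).trans (add_le_add_right ?_ _)
  set Q := spectralProj (U * X * star U) k
  have hQ : IsStarProjection Q := isStarProjection_spectralProj _ _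
  have hUs : U * star U = 1 := Unitary.mul_star_self_of_mem hU
  have hQ' : IsStarProjection (star U * Q * U) := by
    constructor
    · change star U * Q * U * (star U * Q * U) = _
      calc star U * Q * U * (star U * Q * U) = star U * (Q * (U * star U) * Q) * U := by
            simp only [mul_assoc]
        _ = _ := by rw [hUs, mul_one, hQ.isIdempotentElem.eq]
    · exact hQ.isSelfAdjoint.conjugate' U
  have h := re_mul_le_excess τ hX k hQ'
  have h2 : τ ((X - (k : ℂ) • 1) * (star U * Q * U))
      = τ ((U * X * star U - (k : ℂ) • 1) * Q) := by
    rw [← mul_assoc, τ.map_mul_comm _ U]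
    congr 1
    have : U * X * star U - (k : ℂ) • 1 = U * (X - (k : ℂ) • 1) * star U := by
      rw [mul_sub, sub_mul, mul_smul_comm, smul_mul_assoc, mul_one, hUs]
    rw [this]
    simp only [mul_assoc]
  rw [h2] at h
  exact h

end Excess

/-! ### Stability of majorization under algebraic operations. -/

section Majorization

open Set

variable {H : Type*} [NormedAddCommGroup H] [InnerProductSpace ℂ H] [CompleteSpace H]
  {M : VonNeumannAlgebra H} {τ : TracialState M} {X Y C : M.toStarSubalgebra}

theorem majorizedBy_iff_kyFan (hX : IsSelfAdjoint X) (hY : IsSelfAdjoint Y) :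
    MajorizedBy (eigenvalueFun τ X) (eigenvalueFun τ Y) ↔
      (∀ t ∈ Icc (0 : ℝ) 1, kyFan τ X t ≤ kyFan τ Y t) ∧ τ X = τ Y := by
  refine and_congr Iff.rfl ?_
  change kyFan τ X 1 = kyFan τ Y 1 ↔ _
  rw [kyFan_one τ hX, kyFan_one τ hY, Complex.ext_iff, τ.im_eq_zero hX, τ.im_eq_zero hY]
  simp

theorem MajorizedBy.refl (f : ℝ → ℝ) : MajorizedBy f f := ⟨fun _ _ => le_rfl, rfl⟩

theorem MajorizedBy.trans {f g h : ℝ → ℝ} (hfg : MajorizedBy f g) (hgh : MajorizedBy g h) :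
    MajorizedBy f h :=
  ⟨fun t ht => (hfg.1 t ht).trans (hgh.1 t ht), hfg.2.trans hgh.2⟩

theorem MajorizedBy.convex_comb (hX : IsSelfAdjoint X) (hY : IsSelfAdjoint Y)
    (hC : IsSelfAdjoint C) (hXC : MajorizedBy (eigenvalueFun τ X) (eigenvalueFun τ C))
    (hYC : MajorizedBy (eigenvalueFun τ Y) (eigenvalueFun τ C)) {a b : ℝ} (ha : 0 ≤ a)
    (hb : 0 ≤ b) (hab : a + b = 1) :
    MajorizedBy (eigenvalueFun τ ((a : ℂ) • X + (b : ℂ) • Y)) (eigenvalueFun τ C) := by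
  have hZ := (isSelfAdjoint_ofReal_smul hX a).add (isSelfAdjoint_ofReal_smul hY b)
  rw [majorizedBy_iff_kyFan hX hC] at hXC
  rw [majorizedBy_iff_kyFan hY hC] at hYC
  rw [majorizedBy_iff_kyFan hZ hC]
  refine ⟨fun t ht => (kyFan_add_le τ hX hY ha hb ht).trans ?_, ?_⟩
  · calc a * kyFan τ X t + b * kyFan τ Y t ≤ a * kyFan τ C t + b * kyFan τ C t := by
          gcongr
          · exact hXC.1 t ht
          · exact hYC.1 t ht
      _ = kyFan τ C t := by rw [← add_mul, hab, one_mul]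
  · rw [map_add, map_smul, map_smul, hXC.2, hYC.2, ← add_smul, ← Complex.ofReal_add, hab,
      Complex.ofReal_one, one_smul]

theorem MajorizedBy.neg (hX : IsSelfAdjoint X) (hC : IsSelfAdjoint C)
    (h : MajorizedBy (eigenvalueFun τ X) (eigenvalueFun τ C)) :
    MajorizedBy (eigenvalueFun τ (-X)) (eigenvalueFun τ (-C)) := by
  rw [majorizedBy_iff_kyFan hX hC] at h
  rw [majorizedBy_iff_kyFan hX.neg hC.neg, map_neg, map_neg, h.2]
  refine ⟨fun t ht => ?_, rfl⟩
  rw [kyFan_neg τ hX ht, kyFan_neg τ hC ht, h.2]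
  linarith [h.1 (1 - t) ⟨by linarith [ht.2], by linarith [ht.1]⟩]

theorem MajorizedBy.pos_affine (hX : IsSelfAdjoint X) (hC : IsSelfAdjoint C)
    (h : MajorizedBy (eigenvalueFun τ X) (eigenvalueFun τ C)) {a : ℝ} (ha : 0 < a) (b : ℝ) :
    MajorizedBy (eigenvalueFun τ ((a : ℂ) • X + (b : ℂ) • 1))
      (eigenvalueFun τ ((a : ℂ) • C + (b : ℂ) • 1)) := by
  have h1 := isSelfAdjoint_ofReal_smul (IsSelfAdjoint.one M.toStarSubalgebra) b
  rw [majorizedBy_iff_kyFan hX hC] at h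
  rw [majorizedBy_iff_kyFan ((isSelfAdjoint_ofReal_smul hX a).add h1)
    ((isSelfAdjoint_ofReal_smul hC a).add h1), map_add, map_smul, h.2, map_add, map_smul,
    map_smul τ.toLinearMap (a : ℂ) C]
  refine ⟨fun t ht => ?_, rfl⟩
  rw [kyFan_smul_add_smul_one τ hX ha b ht, kyFan_smul_add_smul_one τ hC ha b ht]
  have := mul_le_mul_of_nonneg_left (h.1 t ht) ha.le
  linarith

theorem MajorizedBy.affine (hX : IsSelfAdjoint X) (hC : IsSelfAdjoint C)
    (h : MajorizedBy (eigenvalueFun τ X) (eigenvalueFun τ C)) (a b : ℝ) :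
    MajorizedBy (eigenvalueFun τ ((a : ℂ) • X + (b : ℂ) • 1))
      (eigenvalueFun τ ((a : ℂ) • C + (b : ℂ) • 1)) := by
  rcases lt_trichotomy a 0 with ha | rfl | ha
  · have := (h.neg hX hC).pos_affine hX.neg hC.neg (neg_pos.2 ha) b
    simpa only [Complex.ofReal_neg, neg_smul_neg] using this
  · simpa using MajorizedBy.refl _
  · exact h.pos_affine hX hC ha b

theorem MajorizedBy.conj (hX : IsSelfAdjoint X) (hC : IsSelfAdjoint C)
    (h : MajorizedBy (eigenvalueFun τ X) (eigenvalueFun τ C)) {U : M.toStarSubalgebra}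
    (hU : U ∈ unitary _) :
    MajorizedBy (eigenvalueFun τ (U * X * star U)) (eigenvalueFun τ C) := by
  rw [majorizedBy_iff_kyFan hX hC] at h
  rw [majorizedBy_iff_kyFan (hX.conjugate U) hC]
  refine ⟨fun t ht => (kyFan_conj_le τ hX hU ht).trans (h.1 t ht), ?_⟩
  rw [τ.map_mul_comm, ← mul_assoc, Unitary.star_mul_self_of_mem hU, one_mul, h.2]

/-- Only the scalar `b` is majorized by the scalar `b`. -/
theorem eq_smul_one_of_majorizedBy (hX : IsSelfAdjoint X) {b : ℝ}
    (h : MajorizedBy (eigenvalueFun τ X) (eigenvalueFun τ ((b : ℂ) • 1))) :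
    X = (b : ℂ) • 1 := by
  have h1 := isSelfAdjoint_ofReal_smul (IsSelfAdjoint.one M.toStarSubalgebra) b
  rw [majorizedBy_iff_kyFan hX h1] at h
  have hq := isStarProjection_spectralProj X b
  have ht : (τ (spectralProj X b)).re ∈ Icc (0 : ℝ) 1 :=
    ⟨re_nonneg_of_isStarProjection τ hq, re_le_one_of_isStarProjection τ hq⟩
  -- At `t = τ(1_{(b,∞)}(X))` the bound `∫₀ᵗ λ_X ≤ t b` forces `τ((X - b)₊) = 0`, so `X ≤ b`;
  -- equality of traces then finishes.
  have h0 : excess τ X b = 0 := by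
    refine le_antisymm ?_ (excess_nonneg τ hX b)
    linarith [kyFan_spectralProj τ hX b, h.1 _ ht, kyFan_smul_one_le τ b ht]
  have h2 := τ.eq_zero_of_nonneg (sub_mul_spectralProj_nonneg hX b) h0
  have h3 : 0 ≤ (b : ℂ) • 1 - X := by
    have := sub_le_mul_spectralProj hX b
    rw [h2] at this
    exact sub_nonneg.2 (sub_nonpos.1 this)
  refine (sub_eq_zero.1 (τ.eq_zero_of_nonneg h3 ?_)).symm
  rw [map_sub, h.2, sub_self, Complex.zero_re]

end Majorization

/-! ### The properties of `V_C`. -/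

section NumericalRange

open Set

variable {H : Type*} [NormedAddCommGroup H] [InnerProductSpace ℂ H] [CompleteSpace H]
  {M : VonNeumannAlgebra H} {τ : TracialState M} {X T S C C₁ C₂ : M.toStarSubalgebra}

theorem convex_numericalRange (hC : IsSelfAdjoint C) : Convex ℝ (numericalRange τ C T) := by
  rintro _ ⟨X, hX, hXC, rfl⟩ _ ⟨Y, hY, hYC, rfl⟩ a b ha hb hab
  refine ⟨(a : ℂ) • X + (b : ℂ) • Y,
    (isSelfAdjoint_ofReal_smul hX a).add (isSelfAdjoint_ofReal_smul hY b),
    hXC.convex_comb hX hY hC hYC ha hb hab, ?_⟩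
  rw [mul_add, mul_smul_comm, mul_smul_comm, map_add, map_smul, map_smul, Complex.coe_smul,
    Complex.coe_smul]

/-- If `τ (T' X) = f (τ (T X))` for all admissible `X`, then `V_C(T')` is the image of `V_C(T)`. -/
theorem numericalRange_eq_image {T' : M.toStarSubalgebra} {f : ℂ → ℂ}
    (h : ∀ X : M.toStarSubalgebra, IsSelfAdjoint X →
      MajorizedBy (eigenvalueFun τ X) (eigenvalueFun τ C) → τ (T' * X) = f (τ (T * X))) :
    numericalRange τ C T' = f '' numericalRange τ C T := by
  ext z
  constructor
  · rintro ⟨X, hX, hXC, rfl⟩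
    exact ⟨_, ⟨X, hX, hXC, rfl⟩, (h X hX hXC).symm⟩
  · rintro ⟨_, ⟨X, hX, hXC, rfl⟩, rfl⟩
    exact ⟨X, hX, hXC, h X hX hXC⟩

theorem map_star_mul_of_isSelfAdjoint (hX : IsSelfAdjoint X) :
    τ (star T * X) = starRingEnd ℂ (τ (T * X)) := by
  rw [← τ.map_star, star_mul, hX.star_eq, τ.map_mul_comm]

theorem map_realPart_mul (hX : IsSelfAdjoint X) :
    τ ((ℜ T : M.toStarSubalgebra) * X) = ((τ (T * X)).re : ℂ) := by
  rw [realPart_apply_coe, ← Complex.coe_smul, smul_mul_assoc, map_smul, add_mul, map_add,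
    map_star_mul_of_isSelfAdjoint hX, Complex.add_conj, smul_eq_mul]
  push_cast
  ring

theorem map_imaginaryPart_mul (hX : IsSelfAdjoint X) :
    τ ((ℑ T : M.toStarSubalgebra) * X) = ((τ (T * X)).im : ℂ) := by
  rw [imaginaryPart_apply_coe, ← Complex.coe_smul, smul_mul_assoc, map_smul, smul_mul_assoc,
    map_smul, sub_mul, map_sub, map_star_mul_of_isSelfAdjoint hX, Complex.sub_conj,
    smul_eq_mul, smul_eq_mul]
  push_cast
  linear_combination (-((τ (T * X)).im : ℂ)) * Complex.I_mul_I

theorem numericalRange_add_subset :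
    numericalRange τ C (T + S) ⊆ numericalRange τ C T + numericalRange τ C S := by
  rintro _ ⟨X, hX, hXC, rfl⟩
  exact ⟨_, ⟨X, hX, hXC, rfl⟩, _, ⟨X, hX, hXC, rfl⟩, by rw [add_mul, map_add]⟩

theorem numericalRange_smul_one_add_smul (hC : IsSelfAdjoint C) (z w : ℂ) :
    numericalRange τ C (z • 1 + w • T) = {z * τ C} + w • numericalRange τ C T := by
  rw [singleton_add, ← image_smul, image_image]
  refine numericalRange_eq_image fun X hX hXC => ?_
  rw [add_mul, smul_mul_assoc, smul_mul_assoc, one_mul, map_add, map_smul, map_smul,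
    ((majorizedBy_iff_kyFan hX hC).1 hXC).2, smul_eq_mul]

/-- Traciality moves the conjugation from `T` to the admissible `X`. -/
theorem numericalRange_conj_subset (hC : IsSelfAdjoint C) {U : M.toStarSubalgebra}
    (hU : U ∈ unitary M.toStarSubalgebra) :
    numericalRange τ C (star U * T * U) ⊆ numericalRange τ C T := by
  rintro _ ⟨X, hX, hXC, rfl⟩
  refine ⟨U * X * star U, hX.conjugate U, hXC.conj hX hC hU, ?_⟩
  rw [← mul_assoc, τ.map_mul_comm]
  simp only [mul_assoc]

theorem numericalRange_conj (hC : IsSelfAdjoint C) {U : M.toStarSubalgebra}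
    (hU : U ∈ unitary M.toStarSubalgebra) :
    numericalRange τ C (star U * T * U) = numericalRange τ C T := by
  refine (numericalRange_conj_subset hC hU).antisymm ?_
  have hUs : U * star U = 1 := Unitary.mul_star_self_of_mem hU
  have h := numericalRange_conj_subset (τ := τ) (T := star U * T * U) hC (Unitary.star_mem hU)
  have h2 : star (star U) * (star U * T * U) * star U = T := by
    rw [star_star, ← mul_assoc, ← mul_assoc, hUs, one_mul, mul_assoc, hUs, mul_one]
  rwa [h2] at h

theorem numericalRange_mono (h : MajorizedBy (eigenvalueFun τ C₁) (eigenvalueFun τ C₂)) :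
    numericalRange τ C₁ T ⊆ numericalRange τ C₂ T := by
  rintro _ ⟨X, hX, hXC, rfl⟩
  exact ⟨X, hX, hXC.trans h, rfl⟩

theorem map_mul_affine (a b : ℝ) :
    τ (T * ((a : ℂ) • X + (b : ℂ) • 1)) = (a : ℂ) * τ (T * X) + (b : ℂ) * τ T := by
  rw [mul_add, mul_smul_comm, mul_smul_comm, mul_one, map_add, map_smul, map_smul, smul_eq_mul,
    smul_eq_mul]

/-- For `a ≠ 0`, `Y` is the inverse affine image of `X`. For `a = 0`, `X` must be the scalar `b` and
any admissible `Y` will do; `C` is chosen. -/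
theorem exists_affine_of_majorizedBy (hX : IsSelfAdjoint X) (hC : IsSelfAdjoint C) {a b : ℝ}
    (h : MajorizedBy (eigenvalueFun τ X) (eigenvalueFun τ ((a : ℂ) • C + (b : ℂ) • 1))) :
    ∃ Y : M.toStarSubalgebra, IsSelfAdjoint Y ∧
      MajorizedBy (eigenvalueFun τ Y) (eigenvalueFun τ C) ∧ X = (a : ℂ) • Y + (b : ℂ) • 1 := by
  have h1 := isSelfAdjoint_ofReal_smul (IsSelfAdjoint.one M.toStarSubalgebra)
  rcases eq_or_ne a 0 with rfl | ha
  · rw [Complex.ofReal_zero, zero_smul, zero_add] at h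
    exact ⟨C, hC, MajorizedBy.refl _, by
      rw [eq_smul_one_of_majorizedBy hX h, Complex.ofReal_zero, zero_smul, zero_add]⟩
  have ha' : (a : ℂ) ≠ 0 := Complex.ofReal_ne_zero.2 ha
  have h2 := h.affine hX ((isSelfAdjoint_ofReal_smul hC a).add (h1 b)) a⁻¹ (-(a⁻¹ * b))
  have hCC : ((a⁻¹ : ℝ) : ℂ) • ((a : ℂ) • C + (b : ℂ) • (1 : M.toStarSubalgebra))
      + ((-(a⁻¹ * b) : ℝ) : ℂ) • 1 = C := by
    push_cast
    rw [smul_add, smul_smul, smul_smul, inv_mul_cancel₀ ha', one_smul, add_assoc, ← add_smul,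
      add_neg_cancel, zero_smul, add_zero]
  rw [hCC] at h2
  refine ⟨_, (isSelfAdjoint_ofReal_smul hX _).add (h1 _), h2, ?_⟩
  push_cast
  rw [smul_add, smul_smul, smul_smul, mul_inv_cancel₀ ha', one_smul, add_assoc, ← add_smul,
    mul_neg, mul_inv_cancel_left₀ ha', neg_add_cancel, zero_smul, add_zero]

theorem numericalRange_affine (hC : IsSelfAdjoint C) (a b : ℝ) :
    numericalRange τ ((a : ℂ) • C + (b : ℂ) • 1) T
      = (a : ℂ) • numericalRange τ C T + {(b : ℂ) * τ T} := by
  rw [add_singleton, ← image_smul, image_image]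
  ext z
  constructor
  · rintro ⟨X, hX, hXC, rfl⟩
    obtain ⟨Y, hY, hYC, rfl⟩ := exists_affine_of_majorizedBy hX hC hXC
    exact ⟨_, ⟨Y, hY, hYC, rfl⟩, (map_mul_affine a b).symm⟩
  · rintro ⟨_, ⟨Y, hY, hYC, rfl⟩, rfl⟩
    exact ⟨_, (isSelfAdjoint_ofReal_smul hY a).add
      (isSelfAdjoint_ofReal_smul (IsSelfAdjoint.one _) b), hYC.affine hY hC a b,
      map_mul_affine a b⟩

end NumericalRange

end CNumericalRange

open CNumericalRange in
theorem mainTheorem4 {H : Type*} [NormedAddCommGroup H] [InnerProductSpace ℂ H] [CompleteSpace H]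
    (M : VonNeumannAlgebra H) (τ : TracialState M)
    (T S C C₁ C₂ : M.toStarSubalgebra)
    (hC : IsSelfAdjoint C) (hC₁ : IsSelfAdjoint C₁) (hC₂ : IsSelfAdjoint C₂) :
    Convex ℝ (numericalRange τ C T) ∧
    numericalRange τ C (star T) = (starRingEnd ℂ) '' numericalRange τ C T ∧
    numericalRange τ C (ℜ T : M.toStarSubalgebra) = (fun z : ℂ => (z.re : ℂ)) '' numericalRange τ C T ∧
    numericalRange τ C (ℑ T : M.toStarSubalgebra) = (fun z : ℂ => (z.im : ℂ)) '' numericalRange τ C T ∧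
    numericalRange τ C (T + S) ⊆ numericalRange τ C T + numericalRange τ C S ∧
    (∀ z w : ℂ, numericalRange τ C (z • 1 + w • T) = {z * τ C} + w • numericalRange τ C T) ∧
    (∀ U ∈ unitary M.toStarSubalgebra, numericalRange τ C (star U * T * U) = numericalRange τ C T) ∧
    (MajorizedBy (eigenvalueFun τ C₁) (eigenvalueFun τ C₂) → numericalRange τ C₁ T ⊆ numericalRange τ C₂ T) ∧
    (∀ a b : ℝ, numericalRange τ ((a : ℂ) • C + (b : ℂ) • 1) T = (a : ℂ) • numericalRange τ C T + {(b : ℂ) * τ T}) := by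
  exact ⟨convex_numericalRange hC,
    numericalRange_eq_image fun _ hX _ => map_star_mul_of_isSelfAdjoint hX,
    numericalRange_eq_image fun _ hX _ => map_realPart_mul hX,
    numericalRange_eq_image fun _ hX _ => map_imaginaryPart_mul hX,
    numericalRange_add_subset, numericalRange_smul_one_add_smul hC,
    fun _ hU => numericalRange_conj hC hU, numericalRange_mono, numericalRange_affine hC⟩
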